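/- Let $n \ge 0$ be an integer and let $K$ be any field of characteristic $2$. Let $\mathrm{XF}_5^{2n+3}$ be the simple graph on the vertices $1, 2, \dots, 2n+8$ with the edges $$\{1,i\} \text{ and } \{2,i\}\ (3 \le i \le 2n+6),\qquad \{i,i+1\}\ (2 \le i \le 2n+5),$$ $$\{2,2n+7\},\ \{2n+6,2n+7\},\ \{1,2n+8\},\ \{3,2n+8\},$$ and let $G = \mathrm{co\!-\!XF}_5^{2n+3}$ be its complement. Let $J_G$ be the binomial edge ideal of $G$, that is, the ideal of $S = K[x_1,\dots,x_{2n+8},y_1,\dots,y_{2n+8}]$ generated by the binomials $x_iy_j - x_jy_i$ for the edges $\{i,j\}$ of $G$. Then the ring $R_G = S/J_G$ is not F-pure. Here a commutative ring $R$ of prime characteristic $p$ is called F-pure if the $R$-linear Frobenius map $F : R \to F_*R$, $r \mapsto F_*(r^p)$, is pure, i.e. if for every $R$-module $M$ the induced map $M \to M \otimes_R F_*R$ is injective, where $F_*R$ is the additive group of $R$ with the $R$-module structure $r \cdot F_*s = F_*(r^p s)$. -/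

import Mathlib

open scoped TensorProduct

universe u

/-- The `R`-module `F_* R` of a ring `R` of characteristic `p`: the additive group of `R`, on
which `r` acts as multiplication by `r ^ p`. -/
def FrobeniusPushforward (R : Type u) (_p : ℕ) : Type u := R

namespace FrobeniusPushforward

variable (R : Type u) [CommRing R] (p : ℕ)

instance instAddCommGroup : AddCommGroup (FrobeniusPushforward R p) :=
  inferInstanceAs (AddCommGroup R)

/-- The identity map `s ↦ F_* s` of `R` onto `F_* R`, as an isomorphism of additive groups. -/
def of : R ≃+ FrobeniusPushforward R p := AddEquiv.refl R

variable [Fact p.Prime] [CharP R p]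

noncomputable instance instModule : Module R (FrobeniusPushforward R p) :=
  letI : Module R (FrobeniusPushforward R p) := inferInstanceAs (Module R R)
  Module.compHom (FrobeniusPushforward R p) (frobenius R p)

theorem smul_of (r s : R) : r • of R p s = of R p (r ^ p * s) := rfl

/-- The Frobenius map `R → F_* R`, `r ↦ F_* (r ^ p)`, as an `R`-linear map. -/
noncomputable def frobeniusMap : R →ₗ[R] FrobeniusPushforward R p where
  toFun r := of R p (r ^ p)
  map_add' a b := by
    rw [← map_add, add_pow_char]
  map_smul' a b := by
    rw [RingHom.id_apply, smul_of, smul_eq_mul, mul_pow]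

end FrobeniusPushforward

/-- A ring `R` of prime characteristic `p` is F-pure if the `R`-linear Frobenius map `R → F_* R` is
pure: for every `R`-module `M` the induced map `M ≅ M ⊗ R → M ⊗ F_* R` is injective. -/
def IsFPure (R : Type u) [CommRing R] (p : ℕ) [Fact p.Prime] [CharP R p] : Prop :=
  ∀ (M : Type u) [AddCommGroup M] [Module R M],
    Function.Injective
      ((FrobeniusPushforward.frobeniusMap R p).lTensor M ∘ₗ
        (TensorProduct.rid R M).symm.toLinearMap :
          M →ₗ[R] M ⊗[R] FrobeniusPushforward R p)

section BinomialEdge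

variable {V : Type} (G : SimpleGraph V) (K : Type u) [Field K]

/-- The binomial edge ideal `J_G`, generated by the `x_i y_j - x_j y_i` for the edges `{i, j}`, in
the polynomial ring over `K` with variables `x_i = X (Sum.inl i)` and `y_i = X (Sum.inr i)`. -/
noncomputable def binomialEdgeIdeal : Ideal (MvPolynomial (V ⊕ V) K) :=
  Ideal.span {f | ∃ i j : V, G.Adj i j ∧
    f = MvPolynomial.X (Sum.inl i) * MvPolynomial.X (Sum.inr j) -
      MvPolynomial.X (Sum.inl j) * MvPolynomial.X (Sum.inr i)}

/-- The quotient ring `R_G` of the polynomial ring by `J_G`. -/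
abbrev BinomialEdgeRing : Type u :=
  MvPolynomial (V ⊕ V) K ⧸ binomialEdgeIdeal G K

theorem binomialEdgeIdeal_ne_top : binomialEdgeIdeal G K ≠ ⊤ := by
  intro h
  have hle : binomialEdgeIdeal G K ≤
      RingHom.ker (MvPolynomial.constantCoeff (σ := V ⊕ V) (R := K)) := by
    refine Ideal.span_le.2 ?_
    rintro f ⟨i, j, -, rfl⟩
    simp [RingHom.mem_ker]
  have h1 : (1 : MvPolynomial (V ⊕ V) K) ∈ binomialEdgeIdeal G K := by
    rw [h]; trivial
  simpa [RingHom.mem_ker] using hle h1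

instance instNontrivialBinomialEdgeRing : Nontrivial (BinomialEdgeRing G K) :=
  Ideal.Quotient.nontrivial_iff.2 (binomialEdgeIdeal_ne_top G K)

instance instCharPBinomialEdgeRing (p : ℕ) [CharP K p] : CharP (BinomialEdgeRing G K) p :=
  charP_of_injective_algebraMap (algebraMap K (BinomialEdgeRing G K)).injective p

end BinomialEdge

/-- The edges of `XF_5^{2n+3}` in terms of the vertex labels `1, …, 2n+8`, each listed in one
direction. -/
def XF5Edge (n a b : ℕ) : Prop :=
  (a = 1 ∧ 3 ≤ b ∧ b ≤ 2 * n + 6) ∨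
  (a = 2 ∧ 3 ≤ b ∧ b ≤ 2 * n + 6) ∨
  (2 ≤ a ∧ a ≤ 2 * n + 5 ∧ b = a + 1) ∨
  (a = 2 ∧ b = 2 * n + 7) ∨
  (a = 2 * n + 6 ∧ b = 2 * n + 7) ∨
  (a = 1 ∧ b = 2 * n + 8) ∨
  (a = 3 ∧ b = 2 * n + 8)

/-- The graph `XF_5^{2n+3}`; the element `i` of `Fin (2 * n + 8)` is the vertex labelled `i + 1`. -/
def XF5 (n : ℕ) : SimpleGraph (Fin (2 * n + 8)) :=
  SimpleGraph.fromRel fun i j => XF5Edge n (i.val + 1) (j.val + 1)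

/-- The graph `co-XF_5^{2n+3}`, the complement of `XF_5^{2n+3}`. -/
def coXF5 (n : ℕ) : SimpleGraph (Fin (2 * n + 8)) := (XF5 n)ᶜ

/-! Let `M` be the `K`-dual of `R = R_G`. Purity forces `m ⊗ F_* 1 ≠ 0` for every nonzero `m` in
`M`. To each ordered non-edge `(a, b)` of `G` attach `edgeTensor a b`: the functional "coefficient
of `x_a y_b`" tensored with `F_* (x_a y_a x_b y_b)`.

Moving scalars across the tensor product as squares makes these tensors constant under Gallai's
forcing relation on the complement (`edgeTensor_congr_right`, `edgeTensor_congr_left`). In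
`XF_5^{2n+3}` forcing leads from `(1, 4)` to `(4, 1)` (`XF5_forcing`), so in characteristic 2 the
two tensors sum to `0`. But `{1, 4}` is the middle edge of an induced path on four vertices, and
this turns the sum into `m ⊗ F_* 1` with `m ≠ 0` (`edgeTensor_ne_swap`). -/

open MvPolynomial FrobeniusPushforward

/-! ### Purity and tensors with `F_* R` -/

section FPure

variable {R : Type u} [CommRing R] {p : ℕ} [Fact p.Prime] [CharP R p]
  {M : Type u} [AddCommGroup M] [Module R M]

theorem IsFPure.tmul_of_one_ne_zero (h : IsFPure R p) {m : M} (hm : m ≠ 0) :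
    m ⊗ₜ[R] of R p 1 ≠ 0 := by
  intro h0
  refine hm (h M ?_)
  simpa [frobeniusMap] using h0

theorem smul_tmul_of (r s : R) (m : M) :
    (r • m) ⊗ₜ[R] of R p s = m ⊗ₜ[R] of R p (r ^ p * s) := by
  rw [TensorProduct.smul_tmul, smul_of]

theorem tmul_of_add_self [CharP R 2] (m : M) (s : R) :
    m ⊗ₜ[R] of R 2 s + m ⊗ₜ[R] of R 2 s = 0 := by
  rw [← TensorProduct.tmul_add, ← map_add, CharTwo.add_self_eq_zero, map_zero,
    TensorProduct.tmul_zero]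

end FPure

/-! ### The dual module -/

/-- The `K`-dual of a `K`-algebra `R`, as an `R`-module. -/
def AlgebraDual (K R : Type u) [Field K] [CommRing R] [Algebra K R] : Type u := R →ₗ[K] K

namespace AlgebraDual

variable (K R : Type u) [Field K] [CommRing R] [Algebra K R]

noncomputable instance : AddCommGroup (AlgebraDual K R) :=
  inferInstanceAs (AddCommGroup (R →ₗ[K] K))

instance : FunLike (AlgebraDual K R) R K := inferInstanceAs (FunLike (R →ₗ[K] K) R K)

variable {K R}

@[ext] theorem ext {f g : AlgebraDual K R} (h : ∀ t, f t = g t) : f = g := DFunLike.ext _ _ h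

theorem add_apply (f g : AlgebraDual K R) (t : R) : (f + g) t = f t + g t := rfl

theorem zero_apply (t : R) : (0 : AlgebraDual K R) t = 0 := rfl

noncomputable instance : Module R (AlgebraDual K R) where
  smul r f := LinearMap.comp f (LinearMap.mulLeft K r)
  one_smul f := ext fun t => congrArg f (one_mul t)
  mul_smul r s f := ext fun t => congrArg f (by simp [mul_left_comm])
  smul_zero r := rfl
  smul_add r f g := rfl
  add_smul r s f := ext fun t =>
    (congrArg f (add_mul r s t)).trans (LinearMap.map_add (f : R →ₗ[K] K) _ _)
  zero_smul f := ext fun t =>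
    (congrArg f (zero_mul t)).trans (LinearMap.map_zero (f : R →ₗ[K] K))

theorem smul_apply (r : R) (f : AlgebraDual K R) (t : R) : (r • f) t = f (r * t) := rfl

end AlgebraDual

/-! ### Coefficient functionals on the polynomial ring -/

section Functional

variable {V : Type} (K : Type u) [Field K]

/-- The exponent of the monomial `∏ v ∈ A, y_v`. -/
noncomputable def yExponent (A : Finset V) : V ⊕ V →₀ ℕ :=
  ∑ v ∈ A, Finsupp.single (Sum.inr v) 1

theorem yExponent_inl (A : Finset V) (v : V) : yExponent A (Sum.inl v) = 0 := by
  simp [yExponent, Finsupp.finsetSum_apply]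

variable {K}

variable (K) in
/-- The coefficient of `∏ v ∈ A, y_v` in the image of a polynomial under `∑ v ∈ B, y_v ∂/∂x_v`. -/
noncomputable def polarCoeff (B A : Finset V) : MvPolynomial (V ⊕ V) K →ₗ[K] K :=
  lcoeff K (yExponent A) ∘ₗ
    ∑ v ∈ B, LinearMap.mulLeft K (X (Sum.inr v)) ∘ₗ (pderiv (R := K) (Sum.inl v)).toLinearMap

theorem polarCoeff_apply (B A : Finset V) (t : MvPolynomial (V ⊕ V) K) :
    polarCoeff K B A t =
      ∑ v ∈ B, coeff (yExponent A) (X (Sum.inr v) * pderiv (Sum.inl v) t) := by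
  simp [polarCoeff]

variable [DecidableEq V]

theorem yExponent_inr (A : Finset V) (v : V) :
    yExponent A (Sum.inr v) = if v ∈ A then 1 else 0 := by
  simp [yExponent, Finsupp.finsetSum_apply, Finsupp.single_apply]

theorem coeff_yExponent_X_inl_mul (A : Finset V) (v : V) (t : MvPolynomial (V ⊕ V) K) :
    coeff (yExponent A) (X (Sum.inl v) * t) = 0 := by
  rw [coeff_X_mul', if_neg (by simp [yExponent_inl])]

theorem coeff_yExponent_X_inr_mul_of_notMem {A : Finset V} {v : V} (hv : v ∉ A)
    (t : MvPolynomial (V ⊕ V) K) : coeff (yExponent A) (X (Sum.inr v) * t) = 0 := by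
  rw [coeff_X_mul', if_neg (by simp [yExponent_inr, hv])]

theorem coeff_yExponent_X_inr_mul {A : Finset V} {v : V} (hv : v ∈ A)
    (t : MvPolynomial (V ⊕ V) K) :
    coeff (yExponent A) (X (Sum.inr v) * t) = coeff (yExponent (A.erase v)) t := by
  rw [yExponent, ← Finset.add_sum_erase A _ hv, coeff_X_mul, yExponent]

theorem polarCoeff_X_inr_mul (B : Finset V) {A : Finset V} {w : V} (hw : w ∈ A)
    (t : MvPolynomial (V ⊕ V) K) :
    polarCoeff K B A (X (Sum.inr w) * t) = polarCoeff K (B.erase w) (A.erase w) t := by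
  have key (v : V) : coeff (yExponent A)
      (X (Sum.inr v) * pderiv (Sum.inl v) (X (Sum.inr w) * t)) =
      coeff (yExponent (A.erase w)) (X (Sum.inr v) * pderiv (Sum.inl v) t) := by
    rw [Derivation.leibniz, pderiv_X_of_ne (by simp), smul_zero, add_zero, smul_eq_mul,
      mul_left_comm, coeff_yExponent_X_inr_mul hw]
  rw [polarCoeff_apply, polarCoeff_apply, Finset.sum_congr rfl fun v _ => key v]
  refine (Finset.sum_subset (Finset.erase_subset w B) fun v hv hv' => ?_).symm
  obtain rfl : v = w := by simpa [hv] using hv'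
  exact coeff_yExponent_X_inr_mul_of_notMem (by simp) _

theorem polarCoeff_X_inl_mul (B A : Finset V) (i : V) (t : MvPolynomial (V ⊕ V) K) :
    polarCoeff K B A (X (Sum.inl i) * t) =
      if i ∈ B then coeff (yExponent A) (X (Sum.inr i) * t) else 0 := by
  have key (v : V) : coeff (yExponent A)
      (X (Sum.inr v) * pderiv (Sum.inl v) (X (Sum.inl i) * t)) =
      if i = v then coeff (yExponent A) (X (Sum.inr i) * t) else 0 := by
    rw [Derivation.leibniz, smul_eq_mul, smul_eq_mul, mul_add, mul_left_comm, coeff_add,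
      coeff_yExponent_X_inl_mul, zero_add]
    split_ifs with h
    · subst h
      rw [pderiv_X_self, mul_one]
    · rw [pderiv_X_of_ne (by simpa using h), mul_zero, mul_zero, coeff_zero]
  rw [polarCoeff_apply, Finset.sum_congr rfl fun v _ => key v, Finset.sum_ite_eq]

/-- The derivation kills `x_i y_j - x_j y_i` if `B` contains both or neither of `i`, `j`. Otherwise
it gives `± y_i y_j`, and the endpoint outside `B` is outside `A` by closedness, so the coefficient
vanishes. -/
theorem polarCoeff_eq_zero_of_mem (G : SimpleGraph V) {B A : Finset V}
    (h : ∀ i ∈ B, ∀ j ∈ A, G.Adj i j → j ∈ B) {t : MvPolynomial (V ⊕ V) K}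
    (ht : t ∈ binomialEdgeIdeal G K) : polarCoeff K B A t = 0 := by
  have key {i j : V} (hij : G.Adj i j) (hi : i ∈ B) (hj : j ∉ B)
      (p : MvPolynomial (V ⊕ V) K) :
      coeff (yExponent A) (X (Sum.inr j) * p) = 0 :=
    coeff_yExponent_X_inr_mul_of_notMem (fun hjA => hj (h i hi j hjA hij)) _
  -- The functional is only `K`-linear, so the induction over the ideal must carry an arbitrary
  -- multiplier.
  suffices hq : ∀ q, polarCoeff K B A (q * t) = 0 by simpa using hq 1
  induction ht using Submodule.span_induction with
  | zero => simp
  | add _ _ _ _ h1 h2 =>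
    intro q
    rw [mul_add, map_add, h1, h2, add_zero]
  | smul p t _ ht =>
    intro q
    rw [smul_eq_mul, ← mul_assoc, ht]
  | mem t ht =>
    intro q
    obtain ⟨i, j, hij, rfl⟩ := ht
    rw [show q * (X (Sum.inl i) * X (Sum.inr j) - X (Sum.inl j) * X (Sum.inr i)) =
        X (Sum.inl i) * (X (Sum.inr j) * q) - X (Sum.inl j) * (X (Sum.inr i) * q) by ring,
      map_sub, polarCoeff_X_inl_mul, polarCoeff_X_inl_mul,
      mul_left_comm (X (Sum.inr j))]
    by_cases hi : i ∈ B <;> by_cases hj : j ∈ B <;> simp only [hi, hj, if_true, if_false]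
    · exact sub_self _
    · rw [mul_left_comm, key hij hi hj, sub_zero]
    · rw [key hij.symm hj hi, sub_zero]
    · exact sub_self _

theorem polarCoeff_add (B B' A : Finset V) (h : Disjoint B B') (t : MvPolynomial (V ⊕ V) K) :
    polarCoeff K (B ∪ B') A t = polarCoeff K B A t + polarCoeff K B' A t := by
  simp only [polarCoeff_apply, Finset.sum_union h]

theorem polarCoeff_singleton_pair {a b : V} (h : a ≠ b) (t : MvPolynomial (V ⊕ V) K) :
    polarCoeff K {a, b} {a, b} t = polarCoeff K {a} {a, b} t + polarCoeff K {b} {a, b} t :=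
  polarCoeff_add {a} {b} {a, b} (by simpa using h) t

end Functional

/-! ### Edge tensors and forcing -/

section EdgeRing

variable {V : Type} (G : SimpleGraph V) (K : Type u) [Field K]

/-- The class of `x_v` in the ring of `G`. -/
noncomputable def xClass (v : V) : BinomialEdgeRing G K :=
  Ideal.Quotient.mk _ (X (Sum.inl v))

/-- The class of `y_v` in the ring of `G`. -/
noncomputable def yClass (v : V) : BinomialEdgeRing G K :=
  Ideal.Quotient.mk _ (X (Sum.inr v))

variable {G} in
theorem xClass_mul_yClass {i j : V} (h : G.Adj i j) :
    xClass G K i * yClass G K j = xClass G K j * yClass G K i := by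
  simp only [xClass, yClass, ← map_mul]
  exact Ideal.Quotient.eq.2 (Ideal.subset_span ⟨i, j, h, rfl⟩)

variable [DecidableEq V]

/-- The functional induced by `polarCoeff K B A` on the ring of `G`. -/
noncomputable def polarLift (B A : Finset V) (h : ∀ i ∈ B, ∀ j ∈ A, G.Adj i j → j ∈ B) :
    AlgebraDual K (BinomialEdgeRing G K) :=
  ((binomialEdgeIdeal G K).restrictScalars K).liftQ (polarCoeff K B A)
    (fun t ht => LinearMap.mem_ker.2
      (polarCoeff_eq_zero_of_mem G h ((Submodule.restrictScalars_mem K _ t).1 ht))) ∘ₗ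
    (Submodule.Quotient.restrictScalarsEquiv K (binomialEdgeIdeal G K)).symm.toLinearMap

open Classical in
/-- The functional induced by `polarCoeff K B A` on the ring of `G`, or `0` if `B` is not closed
under adjacency in `A`. -/
noncomputable def polarDual (B A : Finset V) : AlgebraDual K (BinomialEdgeRing G K) :=
  if h : ∀ i ∈ B, ∀ j ∈ A, G.Adj i j → j ∈ B then polarLift G K B A h else 0

variable {G}

theorem polarDual_mk {B A : Finset V} (h : ∀ i ∈ B, ∀ j ∈ A, G.Adj i j → j ∈ B)
    (t : MvPolynomial (V ⊕ V) K) :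
    polarDual G K B A (Ideal.Quotient.mk _ t) = polarCoeff K B A t := by
  rw [polarDual, dif_pos h]
  rfl

/-- Exhibits different functionals as multiples of a common one, so that their multipliers can cross
the tensor sign as squares. -/
theorem yClass_smul_polarDual {B A B' A' : Finset V} {w : V}
    (h : ∀ i ∈ B, ∀ j ∈ A, G.Adj i j → j ∈ B) (hw : w ∈ A)
    (hB : B.erase w = B') (hA : A.erase w = A') :
    yClass G K w • polarDual G K B A = polarDual G K B' A' := by
  subst hB hA
  ext t
  obtain ⟨t, rfl⟩ := Ideal.Quotient.mk_surjective t
  rw [AlgebraDual.smul_apply, yClass, ← map_mul, polarDual_mk K h, polarCoeff_X_inr_mul B hw,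
    polarDual_mk]
  intro i hi j hj hij
  simp only [Finset.mem_erase] at hi hj ⊢
  exact ⟨hj.1, h i hi.2 j hj.2 hij⟩

variable [CharP K 2]

variable (G) in
/-- The tensor of the coefficient functional of `x_a y_b` with `F_* (x_a y_a x_b y_b)`. -/
noncomputable def edgeTensor (a b : V) :
    AlgebraDual K (BinomialEdgeRing G K) ⊗[BinomialEdgeRing G K]
      FrobeniusPushforward (BinomialEdgeRing G K) 2 :=
  polarDual G K {a} {a, b} ⊗ₜ
    of _ 2 (xClass G K a * yClass G K a * (xClass G K b * yClass G K b))

/-- Over the common functional for `{a, b, c}` the second factors are `y_c² x_a y_a x_b y_b` and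
`y_b² x_a y_a x_c y_c`, which agree because `x_b y_c = x_c y_b`. -/
theorem edgeTensor_congr_right {a b c : V} (hab : a ≠ b) (hac : a ≠ c) (hbc : G.Adj b c)
    (nab : ¬ G.Adj a b) (nac : ¬ G.Adj a c) : edgeTensor G K a b = edgeTensor G K a c := by
  have hcl : ∀ i ∈ ({a} : Finset V), ∀ j ∈ ({a, b, c} : Finset V), G.Adj i j →
      j ∈ ({a} : Finset V) := by
    simp [nab, nac]
  have hne := hbc.ne
  rw [edgeTensor, edgeTensor,
    ← yClass_smul_polarDual K (w := c) hcl (by simp) (by ext; grind) (by ext; grind),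
    ← yClass_smul_polarDual K (w := b) (B' := {a}) (A' := {a, c}) hcl (by simp) (by ext; grind)
      (by ext; grind), smul_tmul_of, smul_tmul_of]
  congr 2
  linear_combination (xClass G K a * yClass G K a * yClass G K b * yClass G K c) *
    xClass_mul_yClass K hbc

theorem edgeTensor_congr_left {a b c : V} (hab : a ≠ b) (hac : a ≠ c) (hbc : G.Adj b c)
    (nab : ¬ G.Adj a b) (nac : ¬ G.Adj a c) : edgeTensor G K b a = edgeTensor G K c a := by
  have hcl : ∀ i ∈ ({b, c} : Finset V), ∀ j ∈ ({a, b, c} : Finset V), G.Adj i j →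
      j ∈ ({b, c} : Finset V) := by
    simp [G.adj_comm b a, G.adj_comm c a, nab, nac]
  have hne := hbc.ne
  rw [edgeTensor, edgeTensor,
    ← yClass_smul_polarDual K (w := c) hcl (by simp) (by ext; grind) (by ext; grind),
    ← yClass_smul_polarDual K (w := b) (B' := {c}) (A' := {c, a}) hcl (by simp) (by ext; grind)
      (by ext; grind), smul_tmul_of, smul_tmul_of]
  congr 2
  linear_combination (xClass G K a * yClass G K a * yClass G K b * yClass G K c) *
    xClass_mul_yClass K hbc

theorem edgeTensor_add_swap {b c : V} (hbc : b ≠ c) (nbc : ¬ G.Adj b c) :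
    edgeTensor G K b c + edgeTensor G K c b = polarDual G K {b, c} {b, c} ⊗ₜ
      of _ 2 (xClass G K b * yClass G K b * (xClass G K c * yClass G K c)) := by
  rw [edgeTensor, edgeTensor, mul_comm (xClass G K c * yClass G K c), Finset.pair_comm c b,
    ← TensorProduct.add_tmul]
  congr 1
  ext t
  obtain ⟨t, rfl⟩ := Ideal.Quotient.mk_surjective t
  rw [AlgebraDual.add_apply, polarDual_mk, polarDual_mk, polarDual_mk,
    polarCoeff_singleton_pair hbc]
  · exact fun _ _ _ h _ => h
  · simp [G.adj_comm c b, nbc]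
  · simp [nbc]

/-- The induced path is `a, b, c, d` in the complement of `G`. -/
theorem edgeTensor_ne_swap {a b c d : V} (hp : IsFPure (BinomialEdgeRing G K) 2) (hab : a ≠ b)
    (hbc : b ≠ c) (hcd : c ≠ d) (nbc : ¬ G.Adj b c) (hac : G.Adj a c) (hbd : G.Adj b d)
    (had : G.Adj a d) : edgeTensor G K b c ≠ edgeTensor G K c b := by
  have hac' := hac.ne
  have hbd' := hbd.ne
  have had' := had.ne
  have hcl : ∀ i ∈ ({a, b, c, d} : Finset V), ∀ j ∈ ({a, b, c, d} : Finset V), G.Adj i j →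
      j ∈ ({a, b, c, d} : Finset V) := fun _ _ _ h _ => h
  have hcl' : ∀ i ∈ ({b, c, d} : Finset V), ∀ j ∈ ({b, c, d} : Finset V), G.Adj i j →
      j ∈ ({b, c, d} : Finset V) := fun _ _ _ h _ => h
  intro heq
  have hsum := edgeTensor_add_swap K hbc nbc
  -- Characteristic 2 enters here.
  have hz : edgeTensor G K c b + edgeTensor G K c b = 0 := tmul_of_add_self _ _
  rw [heq, hz,
    ← yClass_smul_polarDual K (w := d) hcl' (by simp) (by ext; grind) (by ext; grind),
    ← yClass_smul_polarDual K (w := a) hcl (by simp) (by ext; grind) (by ext; grind),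
    smul_tmul_of, smul_tmul_of] at hsum
  -- The edges `ac`, `bd`, `ad` of `G` make the second factor a perfect square, whose root returns
  -- to the left and leaves `F_* 1`.
  have hsq : yClass G K a ^ 2 * (yClass G K d ^ 2 *
      (xClass G K b * yClass G K b * (xClass G K c * yClass G K c))) =
      (xClass G K d * (yClass G K b * (yClass G K c * yClass G K a))) ^ 2 * 1 := by
    have h1 := xClass_mul_yClass K hac
    have h2 := xClass_mul_yClass K hbd
    have h3 := xClass_mul_yClass K had
    linear_combination
      yClass G K a ^ 2 * yClass G K d * yClass G K b * xClass G K c * yClass G K c * h2 -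
      yClass G K a * yClass G K d * yClass G K b ^ 2 * xClass G K d * yClass G K c * h1 +
      yClass G K a * yClass G K b ^ 2 * xClass G K d * yClass G K c ^ 2 * h3
  rw [hsq, ← smul_tmul_of] at hsum
  refine hp.tmul_of_one_ne_zero ?_ hsum.symm
  -- The left factor takes the value `1` at `1`: it reads the coefficient of `x_d y_a y_b y_c`.
  intro h0
  have h1 := congrArg (fun f => f (1 : BinomialEdgeRing G K)) h0
  simp only [AlgebraDual.smul_apply, AlgebraDual.zero_apply, xClass, yClass, ← map_mul,
    ← map_one (Ideal.Quotient.mk (binomialEdgeIdeal G K))] at h1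
  rw [polarDual_mk K hcl, mul_assoc, polarCoeff_X_inl_mul, if_pos (by simp), mul_assoc,
    mul_assoc, coeff_yExponent_X_inr_mul (by simp), coeff_yExponent_X_inr_mul (by grind),
    coeff_yExponent_X_inr_mul (by grind), coeff_yExponent_X_inr_mul (by grind),
    show ((((({a, b, c, d} : Finset V).erase d).erase b).erase c).erase a) = ∅ by
      ext
      simp only [Finset.mem_erase, Finset.mem_insert, Finset.mem_singleton, Finset.notMem_empty]
      tauto] at h1
  simp [yExponent] at h1

end EdgeRing

/-! ### Forcing in `XF_5^{2n+3}` -/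

/-- Adjacency in `XF_5^{2n+3}` in terms of the vertex labels. -/
def XF5Adj (n a b : ℕ) : Prop := XF5Edge n a b ∨ XF5Edge n b a

theorem XF5Adj.symm {n a b : ℕ} (h : XF5Adj n a b) : XF5Adj n b a := Or.symm h

theorem XF5Adj.one {n b : ℕ} (h : 3 ≤ b) (h' : b ≤ 2 * n + 6) : XF5Adj n 1 b :=
  Or.inl (Or.inl ⟨rfl, h, h'⟩)

theorem XF5Adj.two {n b : ℕ} (h : 3 ≤ b) (h' : b ≤ 2 * n + 6) : XF5Adj n 2 b :=
  Or.inl (Or.inr (Or.inl ⟨rfl, h, h'⟩))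

theorem XF5Adj.succ {n a : ℕ} (h : 2 ≤ a) (h' : a ≤ 2 * n + 5) : XF5Adj n a (a + 1) :=
  Or.inl (Or.inr (Or.inr (Or.inl ⟨h, h', rfl⟩)))

theorem XF5Adj.two_penultimate (n : ℕ) : XF5Adj n 2 (2 * n + 7) := by
  simp [XF5Adj, XF5Edge]

theorem XF5Adj.end_penultimate (n : ℕ) : XF5Adj n (2 * n + 6) (2 * n + 7) := by
  simp [XF5Adj, XF5Edge]

theorem XF5Adj.one_last (n : ℕ) : XF5Adj n 1 (2 * n + 8) := by
  simp [XF5Adj, XF5Edge]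

theorem XF5Adj.three_last (n : ℕ) : XF5Adj n 3 (2 * n + 8) := by
  simp [XF5Adj, XF5Edge]

/-- A function on ordered edges of `XF_5^{2n+3}` that is constant under Gallai's forcing relation is
invariant under reversal of the edge `{1, 4}`. -/
theorem XF5_forcing {α : Type*} (n : ℕ) (g : ℕ → ℕ → α)
    (hg : ∀ a b c, XF5Adj n a b → XF5Adj n a c → ¬ XF5Adj n b c → b ≠ c →
      g a b = g a c ∧ g b a = g c a) :
    g 1 4 = g 4 1 := by
  -- The range starts at 4 because 3 is adjacent to `2n+8`; likewise `h2` stops before `2n+6`, which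
  -- is adjacent to `2n+7`.
  have h1 : ∀ b, 4 ≤ b → b ≤ 2 * n + 6 →
      g 1 b = g 1 (2 * n + 8) ∧ g b 1 = g (2 * n + 8) 1 := fun b _ _ =>
    hg 1 b _ (.one (by omega) (by omega)) (.one_last n) (by unfold XF5Adj XF5Edge; omega)
      (by omega)
  have h12 : ∀ b, 3 ≤ b → b ≤ 2 * n + 6 → g b 1 = g b 2 ∧ g 1 b = g 2 b := fun b _ _ =>
    hg b 1 2 (XF5Adj.one (by omega) (by omega)).symm (XF5Adj.two (by omega) (by omega)).symm
      (by unfold XF5Adj XF5Edge; omega) (by omega)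
  have h2 : ∀ b, 3 ≤ b → b ≤ 2 * n + 5 →
      g 2 b = g 2 (2 * n + 7) ∧ g b 2 = g (2 * n + 7) 2 := fun b _ _ =>
    hg 2 b _ (.two (by omega) (by omega)) (.two_penultimate n) (by unfold XF5Adj XF5Edge; omega)
      (by omega)
  obtain ⟨a1, a2⟩ := h1 4 (by omega) (by omega)
  obtain ⟨a3, a4⟩ := h12 4 (by omega) (by omega)
  obtain ⟨a5, a6⟩ := h2 4 (by omega) (by omega)
  obtain ⟨a7, a8⟩ := h2 3 (by omega) (by omega)
  obtain ⟨a9, a10⟩ := h1 (2 * n + 6) (by omega) (by omega)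
  -- Orientations alternate along the path `3, …, 2n+6`. It has `2n+3` edges, an odd number, so the
  -- class entering at 3 reaches the other end reversed.
  have path : ∀ k, k ≤ n + 1 →
      g (2 * k + 3) (2 * k + 4) = g 4 1 ∧ g (2 * k + 4) (2 * k + 3) = g 1 4 := by
    intro k
    induction k with
    | zero =>
      intro _
      obtain ⟨e1, e2⟩ := hg 3 (2 * n + 8) 2 (.three_last n)
        (XF5Adj.succ (by omega) (by omega)).symm (by unfold XF5Adj XF5Edge; omega) (by omega)
      obtain ⟨e3, e4⟩ := hg 3 (2 * n + 8) 4 (.three_last n) (.succ (by omega) (by omega))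
        (by unfold XF5Adj XF5Edge; omega) (by omega)
      exact ⟨e3.symm.trans (e1.trans (a8.trans (a6.symm.trans a3.symm))),
        e4.symm.trans (e2.trans (a7.trans (a5.symm.trans a4.symm)))⟩
    | succ k ih =>
      intro hk
      obtain ⟨i1, i2⟩ := ih (by omega)
      obtain ⟨e1, e2⟩ := hg (2 * k + 4) (2 * k + 3) (2 * k + 5)
        (XF5Adj.succ (by omega) (by omega)).symm (.succ (by omega) (by omega))
        (by unfold XF5Adj XF5Edge; omega) (by omega)
      obtain ⟨e3, e4⟩ := hg (2 * k + 5) (2 * k + 4) (2 * k + 6)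
        (XF5Adj.succ (by omega) (by omega)).symm (.succ (by omega) (by omega))
        (by unfold XF5Adj XF5Edge; omega) (by omega)
      exact ⟨e3.symm.trans (e2.symm.trans i1), e4.symm.trans (e1.symm.trans i2)⟩
  obtain ⟨-, p2⟩ := path (n + 1) le_rfl
  obtain ⟨e1, -⟩ := hg (2 * n + 6) (2 * n + 5) (2 * n + 7)
    (XF5Adj.succ (by omega) (by omega)).symm (.end_penultimate n)
    (by unfold XF5Adj XF5Edge; omega) (by omega)
  obtain ⟨e2, -⟩ := hg (2 * n + 6) 1 (2 * n + 7)
    (XF5Adj.one (by omega) (by omega)).symm (.end_penultimate n)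
    (by unfold XF5Adj XF5Edge; omega) (by omega)
  exact p2.symm.trans (e1.trans (e2.symm.trans (a10.trans a2.symm)))

/-! ### From labels to vertices, and the conclusion -/

theorem coXF5_adj {n : ℕ} {i j : Fin (2 * n + 8)} :
    (coXF5 n).Adj i j ↔ i ≠ j ∧ ¬ XF5Adj n (i.val + 1) (j.val + 1) := by
  rw [coXF5, SimpleGraph.compl_adj, XF5, SimpleGraph.fromRel_adj, XF5Adj]
  tauto

/-- The vertex of `XF_5^{2n+3}` with a given label; labels out of range are reduced. -/
def XF5Vertex (n a : ℕ) : Fin (2 * n + 8) := Fin.ofNat (2 * n + 8) (a - 1)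

theorem XF5Vertex_val {n a : ℕ} (h : 1 ≤ a) (h' : a ≤ 2 * n + 8) :
    (XF5Vertex n a).val + 1 = a := by
  rw [XF5Vertex, Fin.val_ofNat, Nat.mod_eq_of_lt (by omega)]
  omega

theorem XF5Adj.bounds {n a b : ℕ} (h : XF5Adj n a b) : 1 ≤ a ∧ a ≤ 2 * n + 8 := by
  unfold XF5Adj XF5Edge at h
  omega

theorem XF5Adj.ne {n a b : ℕ} (h : XF5Adj n a b) : a ≠ b := by
  unfold XF5Adj XF5Edge at h
  omega

theorem XF5Vertex_ne {n a b : ℕ} (ha : 1 ≤ a ∧ a ≤ 2 * n + 8) (hb : 1 ≤ b ∧ b ≤ 2 * n + 8)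
    (h : a ≠ b) : XF5Vertex n a ≠ XF5Vertex n b := by
  intro he
  have := congrArg (fun i => i.val + 1) he
  exact h (by simpa only [XF5Vertex_val ha.1 ha.2, XF5Vertex_val hb.1 hb.2] using this)

theorem coXF5_adj_vertex {n a b : ℕ} (ha : 1 ≤ a ∧ a ≤ 2 * n + 8) (hb : 1 ≤ b ∧ b ≤ 2 * n + 8)
    (h : a ≠ b) : (coXF5 n).Adj (XF5Vertex n a) (XF5Vertex n b) ↔ ¬ XF5Adj n a b := by
  rw [coXF5_adj, XF5Vertex_val ha.1 ha.2, XF5Vertex_val hb.1 hb.2]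
  exact and_iff_right (XF5Vertex_ne ha hb h)

theorem mainTheorem7 (K : Type u) [Field K] [CharP K 2] (n : ℕ) :
    ¬ IsFPure (BinomialEdgeRing (coXF5 n) K) 2 := by
  intro hp
  -- `2n+8, 1, 4, 2` is an induced path in `XF_5^{2n+3}` with middle edge `{1, 4}`.
  refine edgeTensor_ne_swap K (a := XF5Vertex n (2 * n + 8)) (b := XF5Vertex n 1)
    (c := XF5Vertex n 4) (d := XF5Vertex n 2) hp (XF5Vertex_ne (by omega) (by omega) (by omega))
    (XF5Vertex_ne (by omega) (by omega) (by omega)) (XF5Vertex_ne (by omega) (by omega) (by omega))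
    ?_ ?_ ?_ ?_ ?_
  · rw [coXF5_adj_vertex (by omega) (by omega) (by omega), not_not]
    exact .one (by omega) (by omega)
  · rw [coXF5_adj_vertex (by omega) (by omega) (by omega)]
    unfold XF5Adj XF5Edge
    omega
  · rw [coXF5_adj_vertex (by omega) (by omega) (by omega)]
    unfold XF5Adj XF5Edge
    omega
  · rw [coXF5_adj_vertex (by omega) (by omega) (by omega)]
    unfold XF5Adj XF5Edge
    omega
  · refine XF5_forcing n
      (fun a b => edgeTensor (coXF5 n) K (XF5Vertex n a) (XF5Vertex n b)) ?_
    intro a b c hab hac hbc hne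
    have ha := hab.bounds
    have hb := hab.symm.bounds
    have hc := hac.symm.bounds
    have nab : ¬ (coXF5 n).Adj (XF5Vertex n a) (XF5Vertex n b) := by
      rwa [coXF5_adj_vertex ha hb hab.ne, not_not]
    have nac : ¬ (coXF5 n).Adj (XF5Vertex n a) (XF5Vertex n c) := by
      rwa [coXF5_adj_vertex ha hc hac.ne, not_not]
    have hbc' := (coXF5_adj_vertex hb hc hne).2 hbc
    have vab := XF5Vertex_ne ha hb hab.ne
    have vac := XF5Vertex_ne ha hc hac.ne
    exact ⟨edgeTensor_congr_right K vab vac hbc' nab nac,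
      edgeTensor_congr_left K vab vac hbc' nab nac⟩
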